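/- Setting. Let $(K,d)$ be a metric space in which every set of finite diameter is relatively compact. Let $(V,E,i,t)$ be a finite directed multigraph with vertex set $V=\{1,\dots,N\}$, edge set $E$, initial-vertex map $i:E\to V$ (assumed surjective) and terminal-vertex map $t:E\to V$. Let $K_1,\dots,K_N$ be a partition of $K$ into non-empty open sets, let $w_e:K\to K$ ($e\in E$) be Borel maps with $w_e(K_{i(e)})\subset K_{t(e)}$, and let $p_e:K\to[0,\infty)$ ($e\in E$) be Borel functions with $\sum_{e\in E}p_e=1$ and $p_e=0$ off $K_{i(e)}$. Assume that each $p_e|_{K_{i(e)}}$ is uniformly continuous and that $p_e|_{K_{i(e)}}\ge\delta$ for all $e$, for some $\delta>0$; and that for some $0<a<1$ $$\sum_{e\in E}p_e(x)\,d(w_ex,w_ey)\le a\,d(x,y)\qquad\text{for all }x,y\in K_j,\ j=1,\dots,N.$$ A Borel probability measure $\mu$ on $K$ is called invariant if $\int\sum_{e}p_e\cdot(f\circ w_e)\,d\mu=\int f\,d\mu$ for all bounded Borel functions $f$. Fix an invariant Borel probability measure $\mu$ and points $x_j\in K_j$, $j=1,\dots,N$. Let $\Sigma=E^{\mathbb Z}$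 with the product topology, let $S$ be the left shift, $(S\sigma)_j=\sigma_{j+1}$, and let the generalized Markov measure $M$ be the Borel probability measure on $\Sigma$ given by $$M(\{\sigma:\sigma_m=e_1,\dots,\sigma_{m+k-1}=e_k\})=\int p_{e_1}(x)\,p_{e_2}(w_{e_1}x)\cdots p_{e_k}(w_{e_{k-1}}\circ\cdots\circ w_{e_1}x)\,d\mu(x)$$ for all $m\in\mathbb Z$, $k\ge1$, $e_1,\dots,e_k\in E$. Let $\Sigma_G=\{\sigma\in\Sigma: t(\sigma_j)=i(\sigma_{j+1})\ \forall j\in\mathbb Z\}$. The coding map is $$F(\sigma)=\lim_{m\to-\infty}w_{\sigma_0}\circ w_{\sigma_{-1}}\circ\cdots\circ w_{\sigma_m}\,x_{i(\sigma_m)},$$ defined for those $\sigma$ for which the limit exists in $K$. Let $D$ be the set of all $\sigma\in\Sigma_G$ for which this limit exists, and $Y=\bigcap_{k\in\mathbb Z}S^k(D)$. A function $h:(X,d)\to\mathbb R$ is Dini-continuous if $\int_0^c\frac{\phi(t)}{t}\,dt<\infty$ for some $c>0$, where $\phi(t)=\sup\{|h(x)-h(y)|:x,y\in X,\ d(x,y)\le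 t\}$. Lemma. (i) $F(\sigma)$ is defined for all $\sigma\in Y$, and $Y$ is a shift-invariant subset of $\Sigma_G$, i.e. $Y\subset\Sigma_G$ and $S(Y)=Y$. (ii) If each $p_e|_{K_{i(e)}}$ is Dini-continuous, then $M(Y)=1$. (iii) If each $p_e|_{K_{i(e)}}$ is Dini-continuous and there is an invariant Borel probability measure $\nu$ on $K$ with $\nu(K_{i(e)})>0$ for all $e\in E$, then $Y$ is dense in $\Sigma_G$. -/

import Mathlib

open MeasureTheory Filter Topology
open scoped ENNReal

/-- A Markov system `(K_{i(e)}, w_e, p_e)_{e ∈ E}` on `K`: a directed multigraph with vertex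
set `V`, edge set `E`, initial and terminal vertex maps `i`, `t`; a partition of `K` into
non-empty Borel vertex sets; Borel maps `w e` with `w e (K_{i(e)}) ⊆ K_{t(e)}`; and Borel
probability functions `p e` vanishing off `K_{i(e)}`. -/
structure MarkovSystem (V E K : Type*) [Fintype E] [MeasurableSpace K] where
  i : E → V
  t : E → V
  /-- `part v` is the vertex set `K_v`. -/
  part : V → Set K
  part_nonempty : ∀ v, (part v).Nonempty
  part_measurable : ∀ v, MeasurableSet (part v)
  part_disjoint : ∀ v v', v ≠ v' → Disjoint (part v) (part v')
  part_cover : ⋃ v, part v = Set.univ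
  w : E → K → K
  w_measurable : ∀ e, Measurable (w e)
  w_mapsTo : ∀ e, Set.MapsTo (w e) (part (i e)) (part (t e))
  p : E → K → ℝ
  p_measurable : ∀ e, Measurable (p e)
  p_nonneg : ∀ e x, 0 ≤ p e x
  p_sum : ∀ x, ∑ e, p e x = 1
  p_zero : ∀ e x, x ∉ part (i e) → p e x = 0

/-- The modulus of uniform continuity `φ(t) = sup {|h x - h y| : d(x,y) ≤ t}`, with values in
`[0, ∞]`. -/
noncomputable def uniformModulus {X : Type*} [MetricSpace X] (h : X → ℝ) (t : ℝ) : ℝ≥0∞ :=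
  ⨆ (x : X) (y : X) (_ : dist x y ≤ t), ENNReal.ofReal |h x - h y|

/-- Dini-continuity: `∫₀ᶜ φ(t)/t dt < ∞` for some `c > 0`. -/
def DiniContinuous {X : Type*} [MetricSpace X] (h : X → ℝ) : Prop :=
  ∃ c : ℝ, 0 < c ∧ ∫⁻ s in Set.Ioo 0 c, uniformModulus h s / ENNReal.ofReal s < ∞

/-- The left shift `(Sσ)_j = σ_{j+1}` on the code space `Σ = E^ℤ`. -/
def leftShift (E : Type*) : Equiv.Perm (ℤ → E) where
  toFun σ j := σ (j + 1)
  invFun σ j := σ (j - 1)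
  left_inv σ := by funext j; simp
  right_inv σ := by funext j; simp

/-- The cylinder `ₘ[e₁,…,e_k] = {σ : σ_m = e₁, …, σ_{m+k-1} = e_k}`. -/
def codeCylinder {E : Type*} (m : ℤ) (l : List E) : Set (ℤ → E) :=
  {σ | ∀ (j : ℕ) (hj : j < l.length), σ (m + j) = l[j]}

namespace MarkovSystem

variable {V E K : Type*} [Fintype E]

section Measurable

variable [MeasurableSpace K] (𝓜 : MarkovSystem V E K)

/-- The Markov operator `U f = ∑ₑ pₑ · (f ∘ wₑ)`. -/
def markovOp (f : K → ℝ) (x : K) : ℝ := ∑ e, 𝓜.p e x * f (𝓜.w e x)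

/-- `U^* μ = μ`, i.e. `∫ U f dμ = ∫ f dμ` for every bounded Borel function `f`. -/
def IsInvariant (μ : Measure K) : Prop :=
  ∀ f : K → ℝ, Measurable f → (∃ C, ∀ x, |f x| ≤ C) → ∫ x, 𝓜.markovOp f x ∂μ = ∫ x, f x ∂μ

/-- `p_{e₁}(x) p_{e₂}(w_{e₁} x) ⋯ p_{e_k}(w_{e_{k-1}} ∘ ⋯ ∘ w_{e₁} x)`. -/
def pathProb : List E → K → ℝ
  | [], _ => 1
  | e :: l, x => 𝓜.p e x * pathProb l (𝓜.w e x)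

/-- `M` is a probability measure with the cylinder values of the generalized Markov measure
associated with `μ`. -/
structure IsGeneralizedMarkovMeasure [MeasurableSpace E] (μ : Measure K)
    (M : Measure (ℤ → E)) : Prop where
  isProbabilityMeasure : IsProbabilityMeasure M
  cylinder_eq : ∀ (m : ℤ) (l : List E),
    M (codeCylinder m l) = ∫⁻ x, ENNReal.ofReal (𝓜.pathProb l x) ∂μ

open Classical in
/-- The generalized Markov measure associated with `μ`: the probability measure on the code
space with the prescribed values on cylinders (at most one exists, since the cylinders determine
a probability measure on the product σ-algebra; the value `0` is taken if there is none, which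
does not happen when `μ` is an invariant probability measure). -/
noncomputable def generalizedMarkovMeasure [MeasurableSpace E] (μ : Measure K) :
    Measure (ℤ → E) :=
  if h : ∃ M, 𝓜.IsGeneralizedMarkovMeasure μ M then h.choose else 0

/-- `Σ_G = {σ : t(σ_j) = i(σ_{j+1}) for all j ∈ ℤ}`. -/
def pathSpace : Set (ℤ → E) := {σ | ∀ j : ℤ, 𝓜.t (σ j) = 𝓜.i (σ (j + 1))}

/-- `w_{σ_0} ∘ w_{σ_{-1}} ∘ ⋯ ∘ w_{σ_{-n}}`. -/
def backwardComp (σ : ℤ → E) : ℕ → K → K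
  | 0 => 𝓜.w (σ 0)
  | n + 1 => backwardComp σ n ∘ 𝓜.w (σ (-((n : ℤ) + 1)))

/-- `w_{σ_0} ∘ w_{σ_{-1}} ∘ ⋯ ∘ w_{σ_m} x_{i(σ_m)}` with `m = -n`. -/
def codingSeq (x : V → K) (σ : ℤ → E) (n : ℕ) : K :=
  𝓜.backwardComp σ n (x (𝓜.i (σ (-(n : ℤ)))))

end Measurable

section Metric

variable [MetricSpace K] [MeasurableSpace K] (𝓜 : MarkovSystem V E K)

/-- Contractiveness on average with rate `a`. -/
def IsContractive (a : ℝ) : Prop :=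
  0 < a ∧ a < 1 ∧ ∀ v, ∀ x ∈ 𝓜.part v, ∀ y ∈ 𝓜.part v,
    ∑ e, 𝓜.p e x * dist (𝓜.w e x) (𝓜.w e y) ≤ a * dist x y

/-- The coding map `F = F_{(x_v)}`, a partial function on the code space: `F σ` is defined iff the
limit of `w_{σ_0} ∘ ⋯ ∘ w_{σ_m} x_{i(σ_m)}` as `m → -∞` exists, and is then that limit. -/
noncomputable def codingMap (x : V → K) : (ℤ → E) →. K := fun σ =>
  ⟨∃ y, Tendsto (𝓜.codingSeq x σ) atTop (𝓝 y), fun h => h.choose⟩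

/-- `D`: the `σ ∈ Σ_G` for which the limit defining the coding map exists. -/
def codingDomain (x : V → K) : Set (ℤ → E) :=
  {σ | σ ∈ 𝓜.pathSpace ∧ ∃ y, Tendsto (𝓜.codingSeq x σ) atTop (𝓝 y)}

/-- `Y = ⋂_{k ∈ ℤ} S^k(D)`. -/
def Y (x : V → K) : Set (ℤ → E) :=
  ⋂ k : ℤ, ((leftShift E ^ k : Equiv.Perm (ℤ → E)) : (ℤ → E) → (ℤ → E)) '' 𝓜.codingDomain x

/-- Each `p_e` restricted to `K_{i(e)}` is Dini-continuous. -/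
def HasDiniProbabilities : Prop :=
  ∀ e, DiniContinuous (fun z : 𝓜.part (𝓜.i e) => 𝓜.p e z)

end Metric

end MarkovSystem

/-! Run the random path of the system from an initial law `μ`. For σ in Σ_G, consecutive terms of
the coding sequence arise by applying one and the same map, w_{σ_0} ∘ ⋯ ∘ w_{σ_{-n}}, to two points
of a common vertex set. Comparing both with the random trajectory itself, whose letters are drawn
with the probabilities p_e along it, contraction on average bounds the expected gap by a^n times a
constant (`pathExpect_codingDefect_le`). The constant is finite because the distance to the base
points is a drift function for the Markov operator, hence integrable under every invariant measure
(`lintegral_le_of_drift`). So the gaps are almost surely summable and, K being complete, the limit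
exists almost surely (`ae_mem_codingDomain`). Shift invariance of the Markov measure and
countability of ℤ then give full measure to Y.

For density, the lower bound δ and positive mass of every K_{i(e)} give positive measure to each
cylinder around a point of Σ_G (`codeWord_pos`), so each such cylinder meets Y. The Markov measure
itself is obtained by compactness from measures that are eventually correct on every cylinder
(`exists_isGeneralizedMarkovMeasure`). -/

/-! ### Cylinders, words and the shift. -/

theorem mem_codeCylinder_cons {E : Type*} {m : ℤ} {e : E} {l : List E} {σ : ℤ → E} :
    σ ∈ codeCylinder m (e :: l) ↔ σ m = e ∧ σ ∈ codeCylinder (m + 1) l := by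
  constructor
  · intro h
    have h0 := h 0 (Nat.succ_pos _)
    rw [Nat.cast_zero, add_zero] at h0
    refine ⟨h0, fun j hj => ?_⟩
    have := h (j + 1) (by simpa using hj)
    simp only [List.getElem_cons_succ] at this
    rw [← this]; congr 1; push_cast; ring
  · rintro ⟨h0, h⟩ j hj
    cases j with
    | zero => simpa using h0
    | succ j =>
      simp only [List.getElem_cons_succ]
      rw [← h j (by simpa using hj)]; congr 1; push_cast; ring

theorem codeCylinder_nil {E : Type*} (m : ℤ) : codeCylinder m ([] : List E) = Set.univ := by
  ext σ; simp [codeCylinder]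

theorem mem_codeCylinder_append_singleton {E : Type*} {m : ℤ} {e : E} {l : List E} {σ : ℤ → E} :
    σ ∈ codeCylinder m (l ++ [e]) ↔ σ ∈ codeCylinder m l ∧ σ (m + l.length) = e := by
  induction l generalizing m with
  | nil => simp [mem_codeCylinder_cons, codeCylinder_nil]
  | cons b l ih =>
    rw [List.cons_append, mem_codeCylinder_cons, mem_codeCylinder_cons, ih, List.length_cons]
    have : m + 1 + (l.length : ℤ) = m + ((l.length + 1 : ℕ) : ℤ) := by push_cast; ring
    rw [this, and_assoc]

theorem measurableSet_codeCylinder {E : Type*} [MeasurableSpace E] [MeasurableSingletonClass E]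
    (m : ℤ) (l : List E) : MeasurableSet (codeCylinder m l) := by
  induction l generalizing m with
  | nil => rw [codeCylinder_nil]; exact MeasurableSet.univ
  | cons e l ih =>
    have : codeCylinder m (e :: l) = (fun σ : ℤ → E => σ m) ⁻¹' {e} ∩ codeCylinder (m + 1) l := by
      ext σ; exact mem_codeCylinder_cons
    rw [this]
    exact (measurable_pi_apply m (measurableSet_singleton e)).inter (ih _)

theorem isClopen_codeCylinder {E : Type*} [TopologicalSpace E] [DiscreteTopology E]
    (m : ℤ) (l : List E) : IsClopen (codeCylinder m l) := by
  induction l generalizing m with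
  | nil => rw [codeCylinder_nil]; exact isClopen_univ
  | cons e l ih =>
    have : codeCylinder m (e :: l) = (fun σ : ℤ → E => σ m) ⁻¹' {e} ∩ codeCylinder (m + 1) l := by
      ext σ; exact mem_codeCylinder_cons
    rw [this]
    exact ((isClopen_discrete {e}).preimage (continuous_apply m)).inter (ih _)

theorem leftShift_zpow_apply {E : Type*} (k : ℤ) (σ : ℤ → E) :
    (leftShift E ^ k : Equiv.Perm (ℤ → E)) σ = fun j => σ (j + k) := by
  induction k generalizing σ with
  | zero => simp
  | succ n ih =>
    rw [zpow_add, zpow_one, Equiv.Perm.mul_apply, ih]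
    funext j
    change σ (j + n + 1) = _
    rw [add_assoc]
  | pred n ih =>
    rw [zpow_sub, zpow_one, Equiv.Perm.mul_apply, ih]
    funext j
    change σ (j + -n - 1) = _
    congr 1; ring

/-- The word `(σ_m, …, σ_{m+k-1})`. -/
def codeWord {E : Type*} (σ : ℤ → E) : ℤ → ℕ → List E
  | _, 0 => []
  | m, k + 1 => σ m :: codeWord σ (m + 1) k

theorem mem_codeCylinder_codeWord {E : Type*} {σ τ : ℤ → E} {m : ℤ} {k : ℕ} :
    τ ∈ codeCylinder m (codeWord σ m k) ↔ ∀ j < k, τ (m + (j : ℕ)) = σ (m + (j : ℕ)) := by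
  induction k generalizing m with
  | zero => simp [codeWord, codeCylinder_nil]
  | succ k ih =>
    rw [codeWord, mem_codeCylinder_cons, ih]
    constructor
    · rintro ⟨h0, h⟩ j hj
      cases j with
      | zero => simpa using h0
      | succ j =>
        have := h j (by omega)
        rwa [add_assoc, add_comm 1 (j : ℤ)] at this
    · intro h
      refine ⟨by simpa using h 0 (by omega), fun j hj => ?_⟩
      have := h (j + 1) (by omega)
      rwa [add_assoc, add_comm 1 (j : ℤ)]

/-- Only countably many words occur, so `G` may be arbitrary and `List E` needs no σ-algebra. -/
theorem measurable_comp_codeWord {E α : Type*} [Countable E] [MeasurableSpace E]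
    [MeasurableSingletonClass E] [MeasurableSpace α] (G : List E → α) (m : ℤ) (k : ℕ) :
    Measurable fun σ : ℤ → E => G (codeWord σ m k) := by
  induction k generalizing m G with
  | zero => exact measurable_const (a := G [])
  | succ k ih =>
    have h : Measurable fun q : E × (ℤ → E) => G (q.1 :: codeWord q.2 (m + 1) k) :=
      measurable_from_prod_countable_right fun e => ih (fun l => G (e :: l)) (m + 1)
    exact h.comp (g := fun q : E × (ℤ → E) => G (q.1 :: codeWord q.2 (m + 1) k))
      (f := fun σ : ℤ → E => (σ m, σ)) ((measurable_pi_apply m).prodMk measurable_id)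

/-! ### The Markov operator, invariance and drift. -/

namespace MarkovSystem

variable {V E K : Type*} [Fintype E]

section Measurable

variable [MeasurableSpace K] (𝓜 : MarkovSystem V E K)

theorem mem_part_of_p_ne_zero {e : E} {z : K} (h : 𝓜.p e z ≠ 0) : z ∈ 𝓜.part (𝓜.i e) := by
  by_contra hz
  exact h (𝓜.p_zero e z hz)

theorem part_eq_of_mem {v v' : V} {z : K} (h : z ∈ 𝓜.part v) (h' : z ∈ 𝓜.part v') : v = v' := by
  by_contra hne
  exact Set.disjoint_left.1 (𝓜.part_disjoint v v' hne) h h'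

theorem exists_mem_part (z : K) : ∃ v, z ∈ 𝓜.part v := by
  have : z ∈ ⋃ v, 𝓜.part v := by rw [𝓜.part_cover]; trivial
  simpa using this

theorem sum_ofReal_p (z : K) : ∑ e, ENNReal.ofReal (𝓜.p e z) = 1 := by
  rw [← ENNReal.ofReal_sum_of_nonneg fun e _ => 𝓜.p_nonneg e z, 𝓜.p_sum, ENNReal.ofReal_one]

/-- The Markov operator on `[0, ∞]`-valued functions. -/
noncomputable def transfer (f : K → ℝ≥0∞) (z : K) : ℝ≥0∞ :=
  ∑ e, ENNReal.ofReal (𝓜.p e z) * f (𝓜.w e z)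

theorem measurable_transfer {f : K → ℝ≥0∞} (hf : Measurable f) : Measurable (𝓜.transfer f) :=
  Finset.measurable_sum _ fun e _ =>
    (𝓜.p_measurable e).ennreal_ofReal.mul (hf.comp (𝓜.w_measurable e))

theorem measurable_transfer_iterate {f : K → ℝ≥0∞} (hf : Measurable f) (k : ℕ) :
    Measurable (𝓜.transfer^[k] f) := by
  induction k with
  | zero => exact hf
  | succ k ih => rw [Function.iterate_succ_apply']; exact 𝓜.measurable_transfer ih

theorem transfer_mono {f g : K → ℝ≥0∞} (h : f ≤ g) : 𝓜.transfer f ≤ 𝓜.transfer g :=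
  fun z => Finset.sum_le_sum fun e _ => mul_le_mul_right (h (𝓜.w e z)) _

theorem transfer_const (c : ℝ≥0∞) : 𝓜.transfer (fun _ => c) = fun _ => c := by
  funext z
  rw [transfer, ← Finset.sum_mul, 𝓜.sum_ofReal_p, one_mul]

theorem transfer_mul_add_const (b c : ℝ≥0∞) (f : K → ℝ≥0∞) (z : K) :
    𝓜.transfer (fun z => b * f z + c) z = b * 𝓜.transfer f z + c := by
  simp only [transfer, mul_add, Finset.sum_add_distrib]
  rw [← Finset.sum_mul, 𝓜.sum_ofReal_p, one_mul, Finset.mul_sum]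
  congr 1
  exact Finset.sum_congr rfl fun e _ => by ring

theorem transfer_iterate_mul_add_const (b c : ℝ≥0∞) (f : K → ℝ≥0∞) (k : ℕ) (z : K) :
    𝓜.transfer^[k] (fun z => b * f z + c) z = b * 𝓜.transfer^[k] f z + c := by
  induction k generalizing f with
  | zero => rfl
  | succ k ih =>
    rw [Function.iterate_succ_apply, Function.iterate_succ_apply, ← ih]
    exact congrFun (congrArg _ (funext fun z => 𝓜.transfer_mul_add_const b c f z)) z

theorem transfer_iterate_le_const {c : ℝ≥0∞} {f : K → ℝ≥0∞} (h : ∀ z, f z ≤ c) (k : ℕ) (z : K) :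
    𝓜.transfer^[k] f z ≤ c := by
  induction k generalizing z with
  | zero => exact h z
  | succ k ih =>
    rw [Function.iterate_succ_apply']
    exact (𝓜.transfer_mono ih z).trans_eq (congrFun (𝓜.transfer_const c) z)

theorem transfer_iterate_mono {f g : K → ℝ≥0∞} (h : f ≤ g) (k : ℕ) :
    𝓜.transfer^[k] f ≤ 𝓜.transfer^[k] g := by
  induction k with
  | zero => exact h
  | succ k ih => simp only [Function.iterate_succ_apply']; exact 𝓜.transfer_mono ih

variable {𝓜} in
-- Testing invariance on indicators turns it into an identity of measures, from which it extends to
-- unbounded `[0, ∞]`-valued functions.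
theorem IsInvariant.sum_map_withDensity {μ : Measure K} [IsProbabilityMeasure μ]
    (hμ : 𝓜.IsInvariant μ) :
    ∑ e, (μ.withDensity fun z => ENNReal.ofReal (𝓜.p e z)).map (𝓜.w e) = μ := by
  ext A hA
  have h := hμ (A.indicator 1) (measurable_one.indicator hA)
    ⟨1, fun z => by by_cases hz : z ∈ A <;> simp [hz]⟩
  rw [integral_indicator_one hA] at h
  have hnn : ∀ e z, 0 ≤ 𝓜.p e z * A.indicator (1 : K → ℝ) (𝓜.w e z) := fun e z =>
    mul_nonneg (𝓜.p_nonneg e z) (Set.indicator_nonneg (fun _ _ => zero_le_one) _)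
  have hmeas : ∀ e, Measurable fun z => 𝓜.p e z * A.indicator (1 : K → ℝ) (𝓜.w e z) := fun e =>
    (𝓜.p_measurable e).mul ((measurable_one.indicator hA).comp (𝓜.w_measurable e))
  have h2 : ∫⁻ z, ENNReal.ofReal (𝓜.markovOp (A.indicator 1) z) ∂μ = μ A := by
    rw [← ENNReal.ofReal_toReal (measure_ne_top μ A)]
    change _ = ENNReal.ofReal (μ.real A)
    rw [← h, ofReal_integral_eq_lintegral_ofReal]
    · refine Integrable.of_bound (C := 1)
        (Finset.measurable_sum _ fun e _ => hmeas e).aestronglyMeasurable (ae_of_all _ fun z => ?_)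
      have h0 : 0 ≤ 𝓜.markovOp (A.indicator 1) z := Finset.sum_nonneg fun e _ => hnn e z
      rw [Real.norm_of_nonneg h0, ← 𝓜.p_sum z]
      refine Finset.sum_le_sum fun e _ => mul_le_of_le_one_right (𝓜.p_nonneg e z) ?_
      by_cases hz : 𝓜.w e z ∈ A <;> simp [hz]
    · exact ae_of_all _ fun z => Finset.sum_nonneg fun e _ => hnn e z
  rw [← h2, Measure.finsetSum_apply]
  simp only [markovOp]
  simp_rw [ENNReal.ofReal_sum_of_nonneg fun e (_ : e ∈ Finset.univ) => hnn e _]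
  rw [lintegral_finsetSum _ fun e _ => (hmeas e).ennreal_ofReal]
  refine Finset.sum_congr rfl fun e _ => ?_
  rw [Measure.map_apply (𝓜.w_measurable e) hA, withDensity_apply _ (𝓜.w_measurable e hA),
    ← lintegral_indicator (𝓜.w_measurable e hA)]
  refine lintegral_congr fun z => ?_
  by_cases hz : 𝓜.w e z ∈ A <;> simp [hz]

variable {𝓜} in
theorem IsInvariant.lintegral_transfer {μ : Measure K} [IsProbabilityMeasure μ]
    (hμ : 𝓜.IsInvariant μ) {f : K → ℝ≥0∞} (hf : Measurable f) :
    ∫⁻ z, 𝓜.transfer f z ∂μ = ∫⁻ z, f z ∂μ := by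
  conv_rhs => rw [← hμ.sum_map_withDensity]
  rw [lintegral_finsetSum_measure]
  simp only [transfer]
  rw [lintegral_finsetSum (f := fun e z => ENNReal.ofReal (𝓜.p e z) * f (𝓜.w e z)) _ fun e _ =>
    (𝓜.p_measurable e).ennreal_ofReal.mul (hf.comp (𝓜.w_measurable e))]
  refine Finset.sum_congr rfl fun e _ => ?_
  rw [lintegral_map hf (𝓜.w_measurable e)]
  exact (lintegral_withDensity_eq_lintegral_mul _ (𝓜.p_measurable e).ennreal_ofReal
    (hf.comp (𝓜.w_measurable e))).symm

variable {𝓜} in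
theorem IsInvariant.lintegral_transfer_iterate {μ : Measure K} [IsProbabilityMeasure μ]
    (hμ : 𝓜.IsInvariant μ) {f : K → ℝ≥0∞} (hf : Measurable f) (k : ℕ) :
    ∫⁻ z, 𝓜.transfer^[k] f z ∂μ = ∫⁻ z, f z ∂μ := by
  induction k with
  | zero => rfl
  | succ k ih =>
    rw [Function.iterate_succ_apply', hμ.lintegral_transfer (𝓜.measurable_transfer_iterate hf k),
      ih]

variable {𝓜} in
/-- A finite drift function for the Markov operator is integrable with respect to every invariant
probability measure. -/
theorem IsInvariant.lintegral_le_of_drift {μ : Measure K} [IsProbabilityMeasure μ]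
    (hμ : 𝓜.IsInvariant μ) {f : K → ℝ≥0∞} (hf : Measurable f) (hfin : ∀ z, f z ≠ ∞)
    {b c d : ℝ≥0∞} (hb : b < 1) (hd : b * d + c ≤ d)
    (h : ∀ z, 𝓜.transfer f z ≤ b * f z + c) : ∫⁻ z, f z ∂μ ≤ d := by
  -- Iterated drift: `b * d + c ≤ d` makes `d` absorb the additive constant at every step.
  have hk : ∀ k z, 𝓜.transfer^[k] f z ≤ b ^ k * f z + d := by
    intro k
    induction k with
    | zero => intro z; simp
    | succ k ih =>
      intro z
      rw [Function.iterate_succ_apply]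
      refine (𝓜.transfer_iterate_mono h k z).trans ?_
      rw [𝓜.transfer_iterate_mul_add_const]
      calc b * 𝓜.transfer^[k] f z + c ≤ b * (b ^ k * f z + d) + c := by gcongr; exact ih z
        _ = b ^ (k + 1) * f z + (b * d + c) := by ring
        _ ≤ b ^ (k + 1) * f z + d := by gcongr
  -- The integral of `f` may a priori be infinite. Truncating at `n` gives a dominating constant, so
  -- letting `k → ∞` removes `b ^ k * f z` and leaves `min d n`.
  have htrunc : ∀ n : ℕ, ∫⁻ z, min (f z) n ∂μ ≤ d := by
    intro n
    have hmin : Measurable fun z => min (f z) (n : ℝ≥0∞) := hf.min measurable_const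
    have hle : ∀ k, ∫⁻ z, min (f z) n ∂μ ≤ ∫⁻ z, min (b ^ k * f z + d) n ∂μ := fun k => by
      rw [← hμ.lintegral_transfer_iterate hmin k]
      refine lintegral_mono fun z => le_min ?_ ?_
      · exact (𝓜.transfer_iterate_mono (fun z => min_le_left _ _) k z).trans (hk k z)
      · exact 𝓜.transfer_iterate_le_const (fun z => min_le_right _ _) k z
    have hlim : Tendsto (fun k : ℕ => ∫⁻ z, min (b ^ k * f z + d) n ∂μ) atTop
        (𝓝 (∫⁻ _, min (0 * 0 + d) n ∂μ)) := by
      refine tendsto_lintegral_of_dominated_convergence (fun _ => (n : ℝ≥0∞))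
        (fun k => ((hf.const_mul _).add_const _).min measurable_const)
        (fun k => ae_of_all _ fun z => min_le_right _ _) (by simp) (ae_of_all _ fun z => ?_)
      refine Tendsto.min (Tendsto.add ?_ tendsto_const_nhds) tendsto_const_nhds
      have := ENNReal.Tendsto.mul_const (b := f z) (ENNReal.tendsto_pow_atTop_nhds_zero_of_lt_one hb)
        (Or.inr (hfin z))
      simpa using this
    refine (ge_of_tendsto' hlim hle).trans ?_
    simp
  have hsup : ∀ z, f z = ⨆ n : ℕ, min (f z) n := fun z => by
    obtain ⟨n, hn⟩ := ENNReal.exists_nat_gt (hfin z)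
    refine le_antisymm ?_ (iSup_le fun n => min_le_left _ _)
    exact (le_min le_rfl hn.le).trans (le_iSup (fun n : ℕ => min (f z) (n : ℝ≥0∞)) n)
  rw [lintegral_congr hsup, lintegral_iSup (fun n => hf.min measurable_const)]
  · exact iSup_le htrunc
  · exact fun m n hmn z => min_le_min_left _ (by exact_mod_cast hmn)

end Measurable

end MarkovSystem

/-! ### Existence of the generalized Markov measure. -/

/-- The cylinder `{τ : τ_r = e₁, …, τ_{r+k-1} = e_k}` of the one-sided code space. -/
def oneSidedCylinder {E : Type*} (r : ℕ) (l : List E) : Set (ℕ → E) :=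
  {τ | ∀ (j : ℕ) (hj : j < l.length), τ (r + j) = l[j]}

theorem measurableSet_oneSidedCylinder {E : Type*} [MeasurableSpace E] [MeasurableSingletonClass E]
    (r : ℕ) (l : List E) : MeasurableSet (oneSidedCylinder r l) := by
  have : oneSidedCylinder r l =
      ⋂ (j : ℕ) (hj : j < l.length), (fun τ : ℕ → E => τ (r + j)) ⁻¹' {l[j]} := by
    ext τ; simp [oneSidedCylinder]
  rw [this]
  exact MeasurableSet.iInter fun j => MeasurableSet.iInter fun hj =>
    measurable_pi_apply (r + j) (measurableSet_singleton l[j])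

/-- Prepend a letter to a one-sided sequence. -/
def consSeq {E : Type*} (e : E) (τ : ℕ → E) : ℕ → E
  | 0 => e
  | n + 1 => τ n

theorem measurable_consSeq {E : Type*} [MeasurableSpace E] (e : E) :
    Measurable (consSeq e) := by
  refine measurable_pi_lambda _ fun n => ?_
  cases n with
  | zero => exact measurable_const (a := e)
  | succ n => exact measurable_pi_apply n

theorem consSeq_mem_succ {E : Type*} {e : E} {τ : ℕ → E} {r : ℕ} {l : List E} :
    consSeq e τ ∈ oneSidedCylinder (r + 1) l ↔ τ ∈ oneSidedCylinder r l := by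
  refine forall₂_congr fun j hj => ?_
  rw [show r + 1 + j = (r + j) + 1 by ring]
  rfl

theorem consSeq_mem_zero_cons {E : Type*} {e e' : E} {τ : ℕ → E} {l : List E} :
    consSeq e τ ∈ oneSidedCylinder 0 (e' :: l) ↔ e = e' ∧ τ ∈ oneSidedCylinder 0 l := by
  constructor
  · intro h
    refine ⟨h 0 (Nat.succ_pos _), fun j hj => ?_⟩
    have := h (j + 1) (by simpa using hj)
    rw [← add_assoc] at this
    exact this
  · rintro ⟨h0, h⟩ j hj
    cases j with
    | zero => exact h0
    | succ j =>
      rw [← add_assoc]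
      exact h j (by simpa using hj)

theorem measurable_reindex_toNat {E : Type*} [MeasurableSpace E] (n : ℕ) :
    Measurable fun (τ : ℕ → E) (j : ℤ) => τ (j + n).toNat :=
  measurable_pi_lambda _ fun j => measurable_pi_apply (j + n).toNat

namespace MarkovSystem

variable {V E K : Type*} [Fintype E] [MeasurableSpace K] (𝓜 : MarkovSystem V E K)

theorem measurable_pathProb (l : List E) : Measurable (𝓜.pathProb l) := by
  induction l with
  | nil => exact measurable_const (a := (1 : ℝ))
  | cons e l ih => exact (𝓜.p_measurable e).mul (ih.comp (𝓜.w_measurable e))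

theorem ofReal_pathProb_cons (e : E) (l : List E) (z : K) :
    ENNReal.ofReal (𝓜.pathProb (e :: l) z) =
      ENNReal.ofReal (𝓜.p e z) * ENNReal.ofReal (𝓜.pathProb l (𝓜.w e z)) :=
  ENNReal.ofReal_mul (𝓜.p_nonneg e z)

section Existence

variable [MeasurableSpace E]

/-- The law of the first `k` letters of the path started at a point of `K`, continued by the
constant letter `e₀`. -/
noncomputable def pathLaw (e₀ : E) : ℕ → K → Measure (ℕ → E)
  | 0, _ => Measure.dirac fun _ => e₀
  | k + 1, z => ∑ e, ENNReal.ofReal (𝓜.p e z) • (pathLaw e₀ k (𝓜.w e z)).map (consSeq e)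

theorem pathLaw_succ_apply (e₀ : E) (k : ℕ) (z : K) {s : Set (ℕ → E)} (hs : MeasurableSet s) :
    𝓜.pathLaw e₀ (k + 1) z s =
      ∑ e, ENNReal.ofReal (𝓜.p e z) * 𝓜.pathLaw e₀ k (𝓜.w e z) (consSeq e ⁻¹' s) := by
  rw [pathLaw, Measure.finsetSum_apply]
  refine Finset.sum_congr rfl fun e _ => ?_
  rw [Measure.smul_apply, smul_eq_mul, Measure.map_apply (measurable_consSeq e) hs]

theorem measurable_pathLaw (e₀ : E) (k : ℕ) : Measurable (𝓜.pathLaw e₀ k) := by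
  refine Measure.measurable_of_measurable_coe _ fun s hs => ?_
  induction k generalizing s with
  | zero => exact measurable_const (a := Measure.dirac (fun _ : ℕ => e₀) s)
  | succ k ih =>
    simp_rw [𝓜.pathLaw_succ_apply e₀ k _ hs]
    exact Finset.measurable_sum _ fun e _ => (𝓜.p_measurable e).ennreal_ofReal.mul
      ((ih (consSeq e ⁻¹' s) (measurable_consSeq e hs)).comp (𝓜.w_measurable e))

theorem pathLaw_univ (e₀ : E) (k : ℕ) (z : K) : 𝓜.pathLaw e₀ k z Set.univ = 1 := by
  induction k generalizing z with
  | zero => simp [pathLaw]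
  | succ k ih =>
    simp_rw [𝓜.pathLaw_succ_apply e₀ k z MeasurableSet.univ, Set.preimage_univ, ih, mul_one]
    exact 𝓜.sum_ofReal_p z

/-- Each unconstrained initial letter costs one application of the Markov operator. The bound `r +
l.length ≤ k` keeps the cylinder clear of the padding by `e₀`. -/
theorem pathLaw_oneSidedCylinder [MeasurableSingletonClass E] (e₀ : E) (k r : ℕ) (l : List E)
    (h : r + l.length ≤ k) (z : K) :
    𝓜.pathLaw e₀ k z (oneSidedCylinder r l) =
      𝓜.transfer^[r] (fun z => ENNReal.ofReal (𝓜.pathProb l z)) z := by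
  induction k generalizing r l z with
  | zero =>
    obtain rfl : r = 0 := by omega
    obtain rfl : l = [] := List.length_eq_zero_iff.1 (by omega)
    simp [pathLaw, oneSidedCylinder, pathProb]
  | succ k ih =>
    rw [𝓜.pathLaw_succ_apply e₀ k z (measurableSet_oneSidedCylinder r l)]
    cases r with
    | succ r =>
      rw [Function.iterate_succ_apply', transfer]
      refine Finset.sum_congr rfl fun e _ => ?_
      rw [← ih r l (by omega)]
      congr 2
      ext τ
      exact consSeq_mem_succ
    | zero =>
      cases l with
      | nil =>
        have : oneSidedCylinder 0 ([] : List E) = Set.univ := by ext; simp [oneSidedCylinder]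
        simp [this, pathLaw_univ, sum_ofReal_p, pathProb]
      | cons e l =>
        rw [Finset.sum_eq_single e]
        · rw [Function.iterate_zero, id, ofReal_pathProb_cons]
          have := ih 0 l (by simpa using h) (𝓜.w e z)
          rw [Function.iterate_zero, id] at this
          rw [← this]
          congr 2
          ext τ
          rw [Set.mem_preimage, consSeq_mem_zero_cons]
          simp
        · intro e' _ hne
          have : consSeq e' ⁻¹' oneSidedCylinder 0 (e :: l) = ∅ := by
            ext τ
            rw [Set.mem_preimage, consSeq_mem_zero_cons]
            simp [hne]
          rw [this, measure_empty, mul_zero]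
        · simp

/-- Approximation of the generalized Markov measure: the letters from `-n` on follow the path
started at time `-n` with law `μ`, for `2n` steps. -/
noncomputable def approxMarkovMeasure (μ : Measure K) (e₀ : E) (n : ℕ) : Measure (ℤ → E) :=
  (μ.bind (𝓜.pathLaw e₀ (2 * n))).map fun τ j => τ (j + n).toNat

theorem isProbabilityMeasure_approxMarkovMeasure (μ : Measure K) [IsProbabilityMeasure μ] (e₀ : E)
    (n : ℕ) : IsProbabilityMeasure (𝓜.approxMarkovMeasure μ e₀ n) := by
  constructor
  rw [approxMarkovMeasure, Measure.map_apply (measurable_reindex_toNat n) MeasurableSet.univ,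
    Set.preimage_univ, Measure.bind_apply MeasurableSet.univ (𝓜.measurable_pathLaw e₀ _).aemeasurable]
  simp [pathLaw_univ]

/-- The cylinder lies in the window from `-n` to `n - 1`, and the `m + n` letters before it are
absorbed by invariance of `μ`. -/
theorem approxMarkovMeasure_codeCylinder [MeasurableSingletonClass E] {μ : Measure K}
    [IsProbabilityMeasure μ] (hμ : 𝓜.IsInvariant μ) (e₀ : E) {n : ℕ} {m : ℤ} {l : List E}
    (hm : 0 ≤ m + n) (hl : m + l.length ≤ n) :
    𝓜.approxMarkovMeasure μ e₀ n (codeCylinder m l) =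
      ∫⁻ z, ENNReal.ofReal (𝓜.pathProb l z) ∂μ := by
  have hpre : (fun (τ : ℕ → E) (j : ℤ) => τ (j + n).toNat) ⁻¹' codeCylinder m l =
      oneSidedCylinder (m + n).toNat l := by
    ext τ
    refine forall₂_congr fun j hj => ?_
    change τ (m + j + n).toNat = _ ↔ _
    rw [show (m + j + n).toNat = (m + n).toNat + j by omega]
  rw [approxMarkovMeasure, Measure.map_apply (measurable_reindex_toNat n)
    (measurableSet_codeCylinder m l), hpre,
    Measure.bind_apply (measurableSet_oneSidedCylinder _ l)
      (𝓜.measurable_pathLaw e₀ _).aemeasurable]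
  simp_rw [𝓜.pathLaw_oneSidedCylinder e₀ (2 * n) (m + n).toNat l (by omega)]
  exact hμ.lintegral_transfer_iterate (𝓜.measurable_pathProb l).ennreal_ofReal _

end Existence

/-- Probability measures on the compact space E^ℤ form a compact space. A limit along an ultrafilter
finer than `atTop` has the right cylinder values: cylinders are clopen, so their measures converge,
and these are eventually constant. -/
theorem exists_isGeneralizedMarkovMeasure [TopologicalSpace E] [DiscreteTopology E]
    [MeasurableSpace E] [BorelSpace E] {μ : Measure K} [IsProbabilityMeasure μ]
    (hμ : 𝓜.IsInvariant μ) : ∃ M, 𝓜.IsGeneralizedMarkovMeasure μ M := by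
  obtain ⟨z⟩ : Nonempty K := nonempty_of_isProbabilityMeasure μ
  obtain ⟨e₀⟩ : Nonempty E := by
    by_contra h
    rw [not_nonempty_iff] at h
    simpa using 𝓜.p_sum z
  let P : ℕ → ProbabilityMeasure (ℤ → E) := fun n =>
    ⟨𝓜.approxMarkovMeasure μ e₀ n, 𝓜.isProbabilityMeasure_approxMarkovMeasure μ e₀ n⟩
  let F : Ultrafilter ℕ := Ultrafilter.of atTop
  obtain ⟨M, -, hM⟩ := isCompact_univ.ultrafilter_le_nhds (F.map P) (by simp)
  have hlim : Tendsto P F (𝓝 M) := hM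
  refine ⟨M, inferInstance, fun m l => ?_⟩
  have h1 := ProbabilityMeasure.tendsto_measure_of_null_frontier_of_tendsto' hlim
    (E := codeCylinder m l) (by rw [(isClopen_codeCylinder m l).frontier_eq]; simp)
  refine tendsto_nhds_unique h1 (tendsto_const_nhds.congr' ?_)
  have hF : (F : Filter ℕ) ≤ atTop := Ultrafilter.of_le _
  refine hF ?_
  filter_upwards [eventually_ge_atTop (m.natAbs + l.length)] with n hn
  exact (𝓜.approxMarkovMeasure_codeCylinder hμ e₀ (by omega) (by omega)).symm

theorem isGeneralizedMarkovMeasure_generalizedMarkovMeasure [TopologicalSpace E]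
    [DiscreteTopology E] [MeasurableSpace E] [BorelSpace E] {μ : Measure K}
    [IsProbabilityMeasure μ] (hμ : 𝓜.IsInvariant μ) :
    𝓜.IsGeneralizedMarkovMeasure μ (𝓜.generalizedMarkovMeasure μ) := by
  have h := 𝓜.exists_isGeneralizedMarkovMeasure hμ
  rw [generalizedMarkovMeasure, dif_pos h]
  exact h.choose_spec

end MarkovSystem

/-! ### Expectations along random paths. -/

namespace MarkovSystem

variable {V E K : Type*} [Fintype E]

section Measurable

variable [MeasurableSpace K] (𝓜 : MarkovSystem V E K)

/-- `w_{e_k} ∘ ⋯ ∘ w_{e₁}` for the word `[e₁, …, e_k]`. -/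
def pathMap : List E → K → K
  | [], z => z
  | e :: l, z => pathMap l (𝓜.w e z)

theorem pathMap_append (l l' : List E) (z : K) :
    𝓜.pathMap (l ++ l') z = 𝓜.pathMap l' (𝓜.pathMap l z) := by
  induction l generalizing z with
  | nil => rfl
  | cons e l ih => exact ih _

theorem measurable_pathMap (l : List E) : Measurable (𝓜.pathMap l) := by
  induction l with
  | nil => exact measurable_id
  | cons e l ih => exact ih.comp (𝓜.w_measurable e)

theorem pathProb_append (l l' : List E) (z : K) :
    𝓜.pathProb (l ++ l') z = 𝓜.pathProb l z * 𝓜.pathProb l' (𝓜.pathMap l z) := by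
  induction l generalizing z with
  | nil => simp [pathProb, pathMap]
  | cons e l ih => simp only [List.cons_append, pathProb, pathMap, ih, mul_assoc]

theorem pathProb_nonneg (l : List E) (z : K) : 0 ≤ 𝓜.pathProb l z := by
  induction l generalizing z with
  | nil => exact zero_le_one
  | cons e l ih => exact mul_nonneg (𝓜.p_nonneg e z) (ih _)

theorem backwardComp_eq_pathMap (σ : ℤ → E) (n : ℕ) (z : K) :
    𝓜.backwardComp σ n z = 𝓜.pathMap (codeWord σ (-n) (n + 1)) z := by
  induction n generalizing z with
  | zero => simp [backwardComp, codeWord, pathMap]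
  | succ n ih =>
    rw [backwardComp, Function.comp_apply, ih]
    change _ = 𝓜.pathMap (codeWord σ (-((n + 1 : ℕ) : ℤ) + 1) (n + 1))
      (𝓜.w (σ (-((n + 1 : ℕ) : ℤ))) z)
    rw [show -((n + 1 : ℕ) : ℤ) + 1 = -n by push_cast; ring, Nat.cast_succ]

/-- The expectation of a function of the first `k` letters of the path started at a point. -/
noncomputable def pathExpect : ℕ → (List E → ℝ≥0∞) → K → ℝ≥0∞
  | 0, G, _ => G []
  | k + 1, G, z => ∑ e, ENNReal.ofReal (𝓜.p e z) * pathExpect k (fun l => G (e :: l)) (𝓜.w e z)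

theorem measurable_pathExpect (k : ℕ) (G : List E → ℝ≥0∞) : Measurable (𝓜.pathExpect k G) := by
  induction k generalizing G with
  | zero => exact measurable_const (a := G [])
  | succ k ih =>
    exact Finset.measurable_sum _ fun e _ => (𝓜.p_measurable e).ennreal_ofReal.mul
      ((ih fun l => G (e :: l)).comp (𝓜.w_measurable e))

theorem pathExpect_mono (k : ℕ) {G H : List E → ℝ≥0∞} (h : ∀ l, G l ≤ H l) (z : K) :
    𝓜.pathExpect k G z ≤ 𝓜.pathExpect k H z := by
  induction k generalizing G H z with
  | zero => exact h []
  | succ k ih =>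
    exact Finset.sum_le_sum fun e _ => mul_le_mul_right (ih (fun l => h (e :: l)) _) _

theorem pathExpect_add (k : ℕ) (G H : List E → ℝ≥0∞) (z : K) :
    𝓜.pathExpect k (fun l => G l + H l) z = 𝓜.pathExpect k G z + 𝓜.pathExpect k H z := by
  induction k generalizing G H z with
  | zero => rfl
  | succ k ih =>
    simp only [pathExpect]
    rw [← Finset.sum_add_distrib]
    refine Finset.sum_congr rfl fun e _ => ?_
    rw [ih (fun l => G (e :: l)) (fun l => H (e :: l)), mul_add]

variable {𝓜} [MeasurableSpace E] {μ : Measure K} {M : Measure (ℤ → E)}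

/-- The prefix `u` is there for the induction: splitting the cylinder by its next letter lengthens
`u` and shortens the remaining word. -/
theorem IsGeneralizedMarkovMeasure.setLIntegral_codeWord [MeasurableSingletonClass E]
    (hM : 𝓜.IsGeneralizedMarkovMeasure μ M) (k : ℕ) (G : List E → ℝ≥0∞) (m : ℤ) (u : List E) :
    ∫⁻ σ in codeCylinder m u, G (codeWord σ (m + u.length) k) ∂M =
      ∫⁻ z, ENNReal.ofReal (𝓜.pathProb u z) * 𝓜.pathExpect k G (𝓜.pathMap u z) ∂μ := by
  induction k generalizing G u with
  | zero =>
    simp only [codeWord, pathExpect]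
    rw [setLIntegral_const, hM.cylinder_eq,
      lintegral_mul_const _ (𝓜.measurable_pathProb u).ennreal_ofReal, mul_comm]
  | succ k ih =>
    have hU : codeCylinder m u = ⋃ e, codeCylinder m (u ++ [e]) := by
      ext σ
      simp [mem_codeCylinder_append_singleton]
    have hdisj : Pairwise (Function.onFun Disjoint fun e => codeCylinder m (u ++ [e])) := by
      intro e e' hne
      refine Set.disjoint_left.2 fun σ h h' => hne ?_
      rw [← (mem_codeCylinder_append_singleton.1 h).2, (mem_codeCylinder_append_singleton.1 h').2]
    rw [hU, lintegral_iUnion (fun e => measurableSet_codeCylinder _ _) hdisj, tsum_fintype]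
    have hstep : ∀ e, ∫⁻ σ in codeCylinder m (u ++ [e]), G (codeWord σ (m + u.length) (k + 1)) ∂M =
        ∫⁻ z, ENNReal.ofReal (𝓜.pathProb u z) * (ENNReal.ofReal (𝓜.p e (𝓜.pathMap u z)) *
          𝓜.pathExpect k (fun l => G (e :: l)) (𝓜.w e (𝓜.pathMap u z))) ∂μ := by
      intro e
      have hlen : m + ((u ++ [e]).length : ℤ) = m + u.length + 1 := by simp [add_assoc]
      have h1 : ∫⁻ σ in codeCylinder m (u ++ [e]), G (codeWord σ (m + u.length) (k + 1)) ∂M =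
          ∫⁻ σ in codeCylinder m (u ++ [e]),
            G (e :: codeWord σ (m + (u ++ [e]).length) k) ∂M := by
        refine setLIntegral_congr_fun (measurableSet_codeCylinder _ _) fun σ hσ => ?_
        simp only [codeWord]
        rw [(mem_codeCylinder_append_singleton.1 hσ).2, hlen]
      rw [h1, ih (fun l => G (e :: l)) (u ++ [e])]
      refine lintegral_congr fun z => ?_
      rw [pathProb_append, pathMap_append, ENNReal.ofReal_mul (𝓜.pathProb_nonneg u z), mul_assoc]
      simp [pathProb, pathMap]
    rw [Finset.sum_congr rfl fun e _ => hstep e, ← lintegral_finsetSum]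
    · refine lintegral_congr fun z => ?_
      rw [pathExpect, Finset.mul_sum]
    · exact fun e _ => (𝓜.measurable_pathProb u).ennreal_ofReal.mul
        (((𝓜.p_measurable e).comp (𝓜.measurable_pathMap u)).ennreal_ofReal.mul
          ((𝓜.measurable_pathExpect k _).comp
            ((𝓜.w_measurable e).comp (𝓜.measurable_pathMap u))))

theorem IsGeneralizedMarkovMeasure.lintegral_codeWord [MeasurableSingletonClass E]
    (hM : 𝓜.IsGeneralizedMarkovMeasure μ M) (k : ℕ) (G : List E → ℝ≥0∞) (m : ℤ) :
    ∫⁻ σ, G (codeWord σ m k) ∂M = ∫⁻ z, 𝓜.pathExpect k G z ∂μ := by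
  have := hM.setLIntegral_codeWord k G m []
  simpa [codeCylinder_nil, pathProb, pathMap] using this

theorem IsGeneralizedMarkovMeasure.map_add_right [MeasurableSingletonClass E]
    (hM : 𝓜.IsGeneralizedMarkovMeasure μ M) (k : ℤ) :
    𝓜.IsGeneralizedMarkovMeasure μ (M.map fun σ j => σ (j + k)) := by
  have hmeas : Measurable fun (σ : ℤ → E) (j : ℤ) => σ (j + k) :=
    measurable_pi_lambda _ fun j => measurable_pi_apply (j + k)
  have := hM.isProbabilityMeasure
  refine ⟨Measure.isProbabilityMeasure_map hmeas.aemeasurable, fun m l => ?_⟩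
  rw [Measure.map_apply hmeas (measurableSet_codeCylinder m l), ← hM.cylinder_eq (m + k) l]
  congr 1
  ext σ
  refine forall₂_congr fun j hj => ?_
  change σ (m + j + k) = _ ↔ _
  rw [add_right_comm]

/-- If p_e(z) p_{e'}(w_e z) ≠ 0, then w_e z lies in both K_{t(e)} and K_{i(e')}, so t(e) = i(e').
Forbidden two-letter cylinders are therefore null, and there are countably many. -/
theorem IsGeneralizedMarkovMeasure.ae_mem_pathSpace [MeasurableSingletonClass E]
    (hM : 𝓜.IsGeneralizedMarkovMeasure μ M) : ∀ᵐ σ ∂M, σ ∈ 𝓜.pathSpace := by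
  have h : ∀ (j : ℤ) (e e' : E), 𝓜.t e ≠ 𝓜.i e' → ∀ᵐ σ ∂M, σ ∉ codeCylinder j [e, e'] := by
    intro j e e' hne
    refine measure_eq_zero_iff_ae_notMem.1 ?_
    rw [hM.cylinder_eq]
    refine (lintegral_congr fun z => ?_).trans lintegral_zero
    rw [ENNReal.ofReal_eq_zero]
    refine le_of_eq ?_
    simp only [pathProb, mul_one]
    by_contra h0
    obtain ⟨h1, h2⟩ := mul_ne_zero_iff.1 h0
    exact hne (𝓜.part_eq_of_mem (𝓜.w_mapsTo e (𝓜.mem_part_of_p_ne_zero h1))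
      (𝓜.mem_part_of_p_ne_zero h2))
  simp only [eventually_imp_distrib_left.symm, ← ae_all_iff] at h
  filter_upwards [h] with σ hσ j
  by_contra hne
  refine hσ j _ _ hne ?_
  simp [mem_codeCylinder_cons, codeCylinder_nil]

end Measurable

/-! ### Contraction on average and integrability of the distance to the base points. -/

section Metric

variable [MetricSpace K] [MeasurableSpace K] {𝓜 : MarkovSystem V E K} {a : ℝ}

theorem IsContractive.sum_ofReal_mul_edist_le (ha : 𝓜.IsContractive a) {v : V} {y z : K}
    (hz : z ∈ 𝓜.part v) (hy : y ∈ 𝓜.part v) :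
    ∑ e, ENNReal.ofReal (𝓜.p e z) * edist (𝓜.w e z) (𝓜.w e y) ≤
      ENNReal.ofReal a * edist z y := by
  simp only [edist_dist]
  rw [← ENNReal.ofReal_mul ha.1.le]
  simp_rw [← ENNReal.ofReal_mul (𝓜.p_nonneg _ z)]
  rw [← ENNReal.ofReal_sum_of_nonneg fun e _ => mul_nonneg (𝓜.p_nonneg e z) dist_nonneg]
  exact ENNReal.ofReal_le_ofReal (ha.2.2 v z hz y hy)

/-- A letter of nonzero probability starts at the common vertex of `z` and `y`, so their images
again share a vertex set and the contraction can be iterated. -/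
theorem IsContractive.pathExpect_edist_le (ha : 𝓜.IsContractive a) (k : ℕ) {v : V} {y z : K}
    (hz : z ∈ 𝓜.part v) (hy : y ∈ 𝓜.part v) :
    𝓜.pathExpect k (fun l => edist (𝓜.pathMap l z) (𝓜.pathMap l y)) z ≤
      ENNReal.ofReal a ^ k * edist z y := by
  induction k generalizing v y z with
  | zero => simp [pathExpect, pathMap]
  | succ k ih =>
    rw [pathExpect]
    calc _ ≤ ∑ e, ENNReal.ofReal (𝓜.p e z) *
          (ENNReal.ofReal a ^ k * edist (𝓜.w e z) (𝓜.w e y)) := by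
          refine Finset.sum_le_sum fun e _ => ?_
          by_cases h0 : 𝓜.p e z = 0
          · simp [h0]
          have hze := 𝓜.mem_part_of_p_ne_zero h0
          obtain rfl := 𝓜.part_eq_of_mem hz hze
          exact mul_le_mul_right (ih (𝓜.w_mapsTo e hz) (𝓜.w_mapsTo e hy)) _
      _ = ENNReal.ofReal a ^ k * ∑ e, ENNReal.ofReal (𝓜.p e z) * edist (𝓜.w e z) (𝓜.w e y) := by
          rw [Finset.mul_sum]
          exact Finset.sum_congr rfl fun e _ => by ring
      _ ≤ ENNReal.ofReal a ^ k * (ENNReal.ofReal a * edist z y) := by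
          gcongr
          exact ha.sum_ofReal_mul_edist_le hz hy
      _ = _ := by ring

variable (𝓜) in
/-- The distance from a point to the base point of its vertex set. -/
noncomputable def baseEDist (x : V → K) (z : K) : ℝ≥0∞ :=
  ⨆ v, (𝓜.part v).indicator (fun z => edist z (x v)) z

theorem baseEDist_of_mem (x : V → K) {v : V} {z : K} (hz : z ∈ 𝓜.part v) :
    𝓜.baseEDist x z = edist z (x v) := by
  refine le_antisymm (iSup_le fun v' => ?_) ?_
  · by_cases hz' : z ∈ 𝓜.part v'
    · obtain rfl := 𝓜.part_eq_of_mem hz hz'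
      simp [hz]
    · simp [hz']
  · refine le_trans ?_ (le_iSup _ v)
    simp [hz]

theorem measurable_baseEDist [BorelSpace K] [Finite V] (x : V → K) :
    Measurable (𝓜.baseEDist x) :=
  Measurable.iSup fun v =>
    (continuous_id.edist continuous_const).measurable.indicator (𝓜.part_measurable v)

theorem baseEDist_ne_top (x : V → K) (z : K) : 𝓜.baseEDist x z ≠ ∞ := by
  obtain ⟨v, hv⟩ := 𝓜.exists_mem_part z
  rw [baseEDist_of_mem x hv]
  exact edist_ne_top _ _

/-- The drift inequality: apply the triangle inequality through the image of the base point, then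
contraction for one part and p_e ≤ 1 for the other. -/
theorem IsContractive.transfer_baseEDist_le (ha : 𝓜.IsContractive a) {x : V → K}
    (hx : ∀ v, x v ∈ 𝓜.part v) (z : K) :
    𝓜.transfer (𝓜.baseEDist x) z ≤ ENNReal.ofReal a * 𝓜.baseEDist x z +
      ∑ e, edist (𝓜.w e (x (𝓜.i e))) (x (𝓜.t e)) := by
  obtain ⟨v, hv⟩ := 𝓜.exists_mem_part z
  calc 𝓜.transfer (𝓜.baseEDist x) z
      ≤ ∑ e, (ENNReal.ofReal (𝓜.p e z) * edist (𝓜.w e z) (𝓜.w e (x v)) +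
          edist (𝓜.w e (x (𝓜.i e))) (x (𝓜.t e))) := by
        refine Finset.sum_le_sum fun e _ => ?_
        by_cases h0 : 𝓜.p e z = 0
        · simp [h0]
        have hze := 𝓜.mem_part_of_p_ne_zero h0
        obtain rfl := 𝓜.part_eq_of_mem hv hze
        have hp : ENNReal.ofReal (𝓜.p e z) ≤ 1 := by
          rw [← 𝓜.sum_ofReal_p z]
          exact Finset.single_le_sum (f := fun e => ENNReal.ofReal (𝓜.p e z))
            (fun _ _ => zero_le) (Finset.mem_univ e)
        rw [baseEDist_of_mem x (𝓜.w_mapsTo e hv)]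
        calc _ ≤ ENNReal.ofReal (𝓜.p e z) * (edist (𝓜.w e z) (𝓜.w e (x (𝓜.i e))) +
              edist (𝓜.w e (x (𝓜.i e))) (x (𝓜.t e))) := by gcongr; exact edist_triangle _ _ _
          _ ≤ _ := by
            rw [mul_add]
            gcongr
            exact mul_le_of_le_one_left zero_le hp
    _ ≤ _ := by
        rw [Finset.sum_add_distrib, baseEDist_of_mem x hv]
        gcongr
        exact ha.sum_ofReal_mul_edist_le hv (hx v)

theorem IsContractive.lintegral_baseEDist_ne_top [BorelSpace K] [Finite V]
    (ha : 𝓜.IsContractive a) {μ : Measure K} [IsProbabilityMeasure μ] (hμ : 𝓜.IsInvariant μ)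
    {x : V → K} (hx : ∀ v, x v ∈ 𝓜.part v) : ∫⁻ z, 𝓜.baseEDist x z ∂μ ≠ ∞ := by
  obtain ⟨ha0, ha1, -⟩ := id ha
  set c : ℝ≥0∞ := ∑ e, edist (𝓜.w e (x (𝓜.i e))) (x (𝓜.t e)) with hc
  have hctop : c ≠ ∞ := by simp [hc, edist_ne_top]
  -- The bound c / (1 - a) is the fixed point of d ↦ a d + c.
  refine ne_top_of_le_ne_top (ENNReal.ofReal_ne_top (r := c.toReal / (1 - a)))
    (hμ.lintegral_le_of_drift (measurable_baseEDist x) (baseEDist_ne_top x)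
      (b := ENNReal.ofReal a) (c := c) (by simpa using ha1) ?_ fun z => ha.transfer_baseEDist_le hx z)
  have h1 : 0 < 1 - a := by linarith
  nth_rewrite 2 [← ENNReal.ofReal_toReal hctop]
  rw [← ENNReal.ofReal_mul ha0.le, ← ENNReal.ofReal_add (by positivity) ENNReal.toReal_nonneg]
  refine ENNReal.ofReal_le_ofReal (le_of_eq ?_)
  field_simp
  ring

end Metric

end MarkovSystem

/-! ### Positivity of cylinders and almost sure convergence of the coding sequence. -/

namespace MarkovSystem

section Measurable

variable {V E K : Type*} [Fintype E] [MeasurableSpace K] {𝓜 : MarkovSystem V E K}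

theorem pow_le_pathProb_codeWord {δ : ℝ} (hδ : 0 < δ)
    (hpδ : ∀ e, ∀ z ∈ 𝓜.part (𝓜.i e), δ ≤ 𝓜.p e z) {σ : ℤ → E} (hσ : σ ∈ 𝓜.pathSpace) (m : ℤ)
    (k : ℕ) {z : K} (hz : z ∈ 𝓜.part (𝓜.i (σ m))) :
    δ ^ k ≤ 𝓜.pathProb (codeWord σ m k) z := by
  induction k generalizing m z with
  | zero => simp [codeWord, pathProb]
  | succ k ih =>
    rw [codeWord, pathProb, pow_succ']
    refine mul_le_mul (hpδ _ _ hz) (ih (m + 1) ?_) (by positivity) (𝓜.p_nonneg _ _)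
    rw [← hσ m]
    exact 𝓜.w_mapsTo _ hz

/-- Paths started in K_{i(σ_m)} follow the word with probability at least δ^k, since an admissible
word keeps every intermediate point in the next initial vertex set. -/
theorem IsGeneralizedMarkovMeasure.codeWord_pos [MeasurableSpace E]
    {μ : Measure K} {M : Measure (ℤ → E)} (hM : 𝓜.IsGeneralizedMarkovMeasure μ M) {δ : ℝ}
    (hδ : 0 < δ) (hpδ : ∀ e, ∀ z ∈ 𝓜.part (𝓜.i e), δ ≤ 𝓜.p e z)
    (hpos : ∀ e, 0 < μ (𝓜.part (𝓜.i e))) {σ : ℤ → E} (hσ : σ ∈ 𝓜.pathSpace) (m : ℤ) (k : ℕ) :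
    0 < M (codeCylinder m (codeWord σ m k)) := by
  rw [hM.cylinder_eq]
  calc 0 < ENNReal.ofReal (δ ^ k) * μ (𝓜.part (𝓜.i (σ m))) :=
        ENNReal.mul_pos (by simpa using pow_pos hδ k) (hpos _).ne'
    _ = ∫⁻ _ in 𝓜.part (𝓜.i (σ m)), ENNReal.ofReal (δ ^ k) ∂μ := (setLIntegral_const _ _).symm
    _ ≤ ∫⁻ z in 𝓜.part (𝓜.i (σ m)), ENNReal.ofReal (𝓜.pathProb (codeWord σ m k) z) ∂μ :=
        setLIntegral_mono' (𝓜.part_measurable _) fun z hz =>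
          ENNReal.ofReal_le_ofReal (pow_le_pathProb_codeWord hδ hpδ hσ m k hz)
    _ ≤ _ := setLIntegral_le_lintegral _ _

end Measurable

variable {V E K : Type*} [Fintype E] [MetricSpace K] [MeasurableSpace K]
  {𝓜 : MarkovSystem V E K} {a : ℝ}

variable (𝓜) in
/-- The distance between the images under a word of the two natural starting points after its
first letter. -/
noncomputable def codingDefect (x : V → K) : List E → ℝ≥0∞
  | [] => 0
  | e :: l => edist (𝓜.pathMap l (x (𝓜.t e))) (𝓜.pathMap l (𝓜.w e (x (𝓜.i e))))

/-- Admissibility identifies i(σ_{-n}) with t(σ_{-n-1}), which makes the gap a function of the word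
alone. -/
theorem edist_codingSeq_succ (x : V → K) {σ : ℤ → E} (hσ : σ ∈ 𝓜.pathSpace) (n : ℕ) :
    edist (𝓜.codingSeq x σ n) (𝓜.codingSeq x σ (n + 1)) =
      𝓜.codingDefect x (codeWord σ (-((n : ℤ) + 1)) (n + 2)) := by
  have hs : -((n : ℤ) + 1) + 1 = -n := by ring
  have h := hσ (-((n : ℤ) + 1))
  rw [hs] at h
  rw [codingSeq, codingSeq, backwardComp, Function.comp_apply, backwardComp_eq_pathMap,
    backwardComp_eq_pathMap, Nat.cast_succ, ← h]
  change _ = edist (𝓜.pathMap (codeWord σ (-((n : ℤ) + 1) + 1) (n + 1)) _)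
    (𝓜.pathMap (codeWord σ (-((n : ℤ) + 1) + 1) (n + 1)) _)
  rw [hs]

/-- The two starting points are deterministic, while contraction holds along the path of `z`.
Inserting the image of w_e z by the triangle inequality leaves two distances, each contracted by a^k
along that path. -/
theorem IsContractive.pathExpect_codingDefect_le (ha : 𝓜.IsContractive a) {x : V → K}
    (hx : ∀ v, x v ∈ 𝓜.part v) (k : ℕ) (z : K) :
    𝓜.pathExpect (k + 1) (𝓜.codingDefect x) z ≤
      ENNReal.ofReal a ^ k * (𝓜.transfer (𝓜.baseEDist x) z + 𝓜.baseEDist x z) := by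
  obtain ⟨v, hv⟩ := 𝓜.exists_mem_part z
  have ha1 : ENNReal.ofReal a ≤ 1 := by simpa using ha.2.1.le
  calc 𝓜.pathExpect (k + 1) (𝓜.codingDefect x) z
      ≤ ∑ e, ENNReal.ofReal (𝓜.p e z) * (ENNReal.ofReal a ^ k * 𝓜.baseEDist x (𝓜.w e z) +
          ENNReal.ofReal a ^ k * edist (𝓜.w e z) (𝓜.w e (x v))) := by
        refine Finset.sum_le_sum fun e _ => ?_
        by_cases h0 : 𝓜.p e z = 0
        · simp [h0]
        have hze := 𝓜.mem_part_of_p_ne_zero h0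
        obtain rfl := 𝓜.part_eq_of_mem hv hze
        refine mul_le_mul_right ?_ _
        refine (𝓜.pathExpect_mono k (fun l => ?_) _).trans ((𝓜.pathExpect_add k
          (fun l => edist (𝓜.pathMap l (𝓜.w e z)) (𝓜.pathMap l (x (𝓜.t e))))
          (fun l => edist (𝓜.pathMap l (𝓜.w e z)) (𝓜.pathMap l (𝓜.w e (x (𝓜.i e))))) _).trans_le
            ?_)
        · exact edist_triangle_left _ _ _
        · rw [baseEDist_of_mem x (𝓜.w_mapsTo e hv)]
          exact add_le_add (ha.pathExpect_edist_le k (𝓜.w_mapsTo e hv) (hx _))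
            (ha.pathExpect_edist_le k (𝓜.w_mapsTo e hv) (𝓜.w_mapsTo e (hx _)))
    _ = ENNReal.ofReal a ^ k * (𝓜.transfer (𝓜.baseEDist x) z +
          ∑ e, ENNReal.ofReal (𝓜.p e z) * edist (𝓜.w e z) (𝓜.w e (x v))) := by
        rw [transfer, ← Finset.sum_add_distrib, Finset.mul_sum]
        exact Finset.sum_congr rfl fun e _ => by ring
    _ ≤ _ := by
        gcongr
        refine (ha.sum_ofReal_mul_edist_le hv (hx v)).trans ?_
        rw [baseEDist_of_mem x hv]
        exact mul_le_of_le_one_left zero_le ha1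

theorem mem_Y_iff {x : V → K} {σ : ℤ → E} :
    σ ∈ 𝓜.Y x ↔ ∀ k : ℤ, (fun j => σ (j + k)) ∈ 𝓜.codingDomain x := by
  simp only [Y, Set.mem_iInter]
  rw [← (Equiv.neg ℤ).forall_congr_right]
  refine forall_congr' fun k => ?_
  rw [Equiv.image_eq_preimage_symm, Set.mem_preimage, Equiv.neg_apply, ← leftShift_zpow_apply,
    zpow_neg]
  rfl

variable [BorelSpace K] [Finite V] [MeasurableSpace E] [MeasurableSingletonClass E]
  {μ : Measure K} {M : Measure (ℤ → E)}

/-- The coding map is defined almost everywhere for the generalized Markov measure. -/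
theorem IsContractive.ae_mem_codingDomain [CompleteSpace K] (ha : 𝓜.IsContractive a)
    [IsProbabilityMeasure μ] (hμ : 𝓜.IsInvariant μ) (hM : 𝓜.IsGeneralizedMarkovMeasure μ M)
    {x : V → K} (hx : ∀ v, x v ∈ 𝓜.part v) : ∀ᵐ σ ∂M, σ ∈ 𝓜.codingDomain x := by
  set I := ∫⁻ z, 𝓜.baseEDist x z ∂μ with hI
  have hIfin : I ≠ ∞ := ha.lintegral_baseEDist_ne_top hμ hx
  have hf := measurable_baseEDist (𝓜 := 𝓜) x
  have hmeas : ∀ n : ℕ, Measurable fun σ : ℤ → E =>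
      𝓜.codingDefect x (codeWord σ (-((n : ℤ) + 1)) (n + 2)) := fun n =>
    measurable_comp_codeWord _ _ _
  -- The word has `n + 2` letters, of which all but the first contract. Invariance of `μ` gives both
  -- distance terms the same integral `I`.
  have hbound : ∀ n : ℕ, ∫⁻ σ, 𝓜.codingDefect x (codeWord σ (-((n : ℤ) + 1)) (n + 2)) ∂M ≤
      ENNReal.ofReal a ^ n * (ENNReal.ofReal a * (I + I)) := by
    intro n
    rw [hM.lintegral_codeWord]
    refine (lintegral_mono fun z => ha.pathExpect_codingDefect_le hx (n + 1) z).trans_eq ?_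
    rw [lintegral_const_mul (f := fun z => 𝓜.transfer (𝓜.baseEDist x) z + 𝓜.baseEDist x z) _
      ((𝓜.measurable_transfer hf).add hf), lintegral_add_right _ hf, hμ.lintegral_transfer hf, pow_succ, mul_assoc]
  have hsum : ∫⁻ σ, ∑' n : ℕ, 𝓜.codingDefect x (codeWord σ (-((n : ℤ) + 1)) (n + 2)) ∂M ≠ ∞ := by
    rw [lintegral_tsum fun n => (hmeas n).aemeasurable]
    refine ne_top_of_le_ne_top ?_ (ENNReal.tsum_le_tsum hbound)
    rw [ENNReal.tsum_mul_right, ENNReal.tsum_geometric]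
    refine ENNReal.mul_ne_top (ENNReal.inv_ne_top.2 ?_)
      (ENNReal.mul_ne_top ENNReal.ofReal_ne_top (ENNReal.add_ne_top.2 ⟨hIfin, hIfin⟩))
    rw [Ne, tsub_eq_zero_iff_le, not_le]
    simpa using ha.2.1
  filter_upwards [hM.ae_mem_pathSpace, ae_lt_top (Measurable.tsum hmeas) hsum] with σ hσ hfin
  refine ⟨hσ, cauchySeq_tendsto_of_complete ?_⟩
  exact cauchySeq_of_edist_le_of_tsum_ne_top _
    (fun n => (edist_codingSeq_succ x hσ n).le) hfin.ne

/-- Every shift of `M` has the same cylinder values, so almost sure convergence applies to each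
shift. Arguing almost everywhere avoids measurability of Y. -/
theorem IsContractive.measure_Y_eq_one [CompleteSpace K] (ha : 𝓜.IsContractive a)
    [IsProbabilityMeasure μ] (hμ : 𝓜.IsInvariant μ) (hM : 𝓜.IsGeneralizedMarkovMeasure μ M)
    {x : V → K} (hx : ∀ v, x v ∈ 𝓜.part v) : M (𝓜.Y x) = 1 := by
  have := hM.isProbabilityMeasure
  have h : ∀ᵐ σ ∂M, σ ∈ 𝓜.Y x := by
    simp only [mem_Y_iff, ae_all_iff]
    intro k
    exact ae_of_ae_map (measurable_pi_lambda _ fun j => measurable_pi_apply (j + k)).aemeasurable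
      (ha.ae_mem_codingDomain hμ (hM.map_add_right k) hx)
  exact (measure_congr (eventuallyEq_univ.2 h : 𝓜.Y x =ᵐ[M] Set.univ)).trans measure_univ

end MarkovSystem

/-! ### Cylinder neighbourhoods and the final assembly. -/

theorem exists_codeCylinder_subset {E : Type*} [TopologicalSpace E] {O : Set (ℤ → E)}
    (hO : IsOpen O) {σ : ℤ → E} (hσ : σ ∈ O) :
    ∃ (m : ℤ) (k : ℕ), codeCylinder m (codeWord σ m k) ⊆ O := by
  obtain ⟨I, u, hu, hsub⟩ := isOpen_pi_iff.1 hO σ hσ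
  -- The finitely many constrained coordinates fit in a symmetric window [-R, R], which has 2R + 1
  -- places.
  refine ⟨-(I.sup Int.natAbs : ℕ), 2 * I.sup Int.natAbs + 1, fun τ hτ => hsub fun j hj => ?_⟩
  rw [mem_codeCylinder_codeWord] at hτ
  have hle : j.natAbs ≤ I.sup Int.natAbs := Finset.le_sup (f := Int.natAbs) hj
  have := hτ (j + (I.sup Int.natAbs : ℕ)).toNat (by omega)
  rw [show -((I.sup Int.natAbs : ℕ) : ℤ) + ((j + (I.sup Int.natAbs : ℕ)).toNat : ℤ) = j by omega]
    at this
  rw [this]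
  exact (hu j hj).2

theorem lemma2 {V E K : Type*} [Finite V] [Fintype E]
    [TopologicalSpace E] [DiscreteTopology E] [MeasurableSpace E] [BorelSpace E]
    [MetricSpace K] [MeasurableSpace K] [BorelSpace K]
    (hK : ∀ s : Set K, Bornology.IsBounded s → IsCompact (closure s))
    (𝓜 : MarkovSystem V E K)
    (a : ℝ) (ha : 𝓜.IsContractive a)
    (hopen : ∀ v, IsOpen (𝓜.part v))
    (huc : ∀ e, UniformContinuousOn (𝓜.p e) (𝓜.part (𝓜.i e)))
    (δ : ℝ) (hδ : 0 < δ) (hpδ : ∀ e, ∀ z ∈ 𝓜.part (𝓜.i e), δ ≤ 𝓜.p e z)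
    (hi : Function.Surjective 𝓜.i)
    (μ : Measure K) [IsProbabilityMeasure μ] (hμ : 𝓜.IsInvariant μ)
    (x : V → K) (hx : ∀ v, x v ∈ 𝓜.part v) :
    ((∀ σ ∈ 𝓜.Y x, ∃ y ∈ 𝓜.codingMap x σ, Tendsto (𝓜.codingSeq x σ) atTop (𝓝 y)) ∧
      𝓜.Y x ⊆ 𝓜.pathSpace ∧ leftShift E '' 𝓜.Y x = 𝓜.Y x) ∧
    (𝓜.HasDiniProbabilities → 𝓜.generalizedMarkovMeasure μ (𝓜.Y x) = 1) ∧
    (𝓜.HasDiniProbabilities →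
      (∃ ν : Measure K, IsProbabilityMeasure ν ∧ 𝓜.IsInvariant ν ∧
        ∀ e, 0 < ν (𝓜.part (𝓜.i e))) →
      Dense {σ : 𝓜.pathSpace | (σ : ℤ → E) ∈ 𝓜.Y x}) := by
  have hdom : ∀ σ ∈ 𝓜.Y x, σ ∈ 𝓜.codingDomain x := fun σ hσ => by
    simpa using MarkovSystem.mem_Y_iff.1 hσ 0
  -- Properness supplies the completeness used for convergence.
  have hproper : ProperSpace K :=
    ⟨fun z r => by simpa using hK (Metric.closedBall z r) Metric.isBounded_closedBall⟩
  refine ⟨⟨fun σ hσ => ?_, fun σ hσ => (hdom σ hσ).1, ?_⟩, fun _ => ?_, ?_⟩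
  · obtain ⟨-, h⟩ := hdom σ hσ
    exact ⟨h.choose, ⟨h, rfl⟩, h.choose_spec⟩
  · ext σ
    rw [Equiv.image_eq_preimage_symm, Set.mem_preimage, MarkovSystem.mem_Y_iff,
      MarkovSystem.mem_Y_iff, ← (Equiv.subRight (1 : ℤ)).forall_congr_right (q := fun k : ℤ =>
        (fun j => σ (j + k)) ∈ 𝓜.codingDomain x)]
    refine forall_congr' fun k => ?_
    rw [show (fun j : ℤ => (leftShift E).symm σ (j + k)) =
      fun j => σ (j + (Equiv.subRight (1 : ℤ)) k) from funext fun j => by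
        change σ (j + k - 1) = σ (j + (k - 1))
        rw [add_sub_assoc]]
  · exact ha.measure_Y_eq_one hμ (𝓜.isGeneralizedMarkovMeasure_generalizedMarkovMeasure hμ) hx
  · rintro - ⟨ν, hνp, hν, hpos⟩
    -- Y does not depend on the invariant measure, so the Markov measure of `ν`, which charges every
    -- vertex set, may replace that of `μ`.
    obtain ⟨M, hM⟩ := 𝓜.exists_isGeneralizedMarkovMeasure hν
    have hY : M (𝓜.Y x) = 1 := ha.measure_Y_eq_one hν hM hx
    have := hM.isProbabilityMeasure
    rw [dense_iff_inter_open]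
    rintro U hU ⟨⟨σ, hσ⟩, hσU⟩
    obtain ⟨O, hO, rfl⟩ := isOpen_induced_iff.1 hU
    obtain ⟨m, k, hsub⟩ := exists_codeCylinder_subset hO hσU
    -- If disjoint from Y, the cylinder would push the total mass above 1. Additivity needs
    -- measurability of the cylinder only.
    obtain ⟨τ, hτ, hτY⟩ : (codeCylinder m (codeWord σ m k) ∩ 𝓜.Y x).Nonempty := by
      by_contra hne
      rw [Set.not_nonempty_iff_eq_empty, ← Set.disjoint_iff_inter_eq_empty] at hne
      have h1 := measure_union' (μ := M) hne (measurableSet_codeCylinder _ _)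
      have h2 : M (codeCylinder m (codeWord σ m k)) + 1 ≤ 1 := by
        rw [← hY, ← h1, hY]
        exact prob_le_one
      have h3 := hM.codeWord_pos hδ hpδ hpos hσ m k
      exact absurd h2 (not_le.2 (by
        rw [add_comm]
        exact ENNReal.lt_add_right ENNReal.one_ne_top h3.ne'))
    exact ⟨⟨τ, (hdom τ hτY).1⟩, hsub hτ, hτY⟩
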